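/- Let $\mathbb{C}_\infty=\mathbb{C}\cup\{\infty\}$ denote the Riemann sphere. A compact set $K\subset\mathbb{C}$ is called $A$-removable if every continuous function $f:\mathbb{C}_\infty\to\mathbb{C}$ that is holomorphic on $\mathbb{C}_\infty\setminus K$ is constant. If $E$ and $F$ are $A$-removable compact subsets of $\mathbb{C}$, then $E\cup F$ is also $A$-removable. -/

import Mathlib

open scoped OnePoint

/-- The coordinate `w = 1 / z` of the Riemann sphere `OnePoint ℂ` around infinity: the
parametrization `w ↦ 1 / w` of the sphere minus the origin, with `0 ↦ ∞`. -/
noncomputable def sphereCoordInfty (w : ℂ) : OnePoint ℂ :=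
  if w = 0 then ∞ else ((w⁻¹ : ℂ) : OnePoint ℂ)

/-- A complex-valued function on the Riemann sphere is holomorphic on the open set `Ω` of the
sphere: it is holomorphic in both standard coordinates, `z` and `w = 1 / z`. -/
def SphereHolomorphicOn (f : OnePoint ℂ → ℂ) (Ω : Set (OnePoint ℂ)) : Prop :=
  DifferentiableOn ℂ (fun z : ℂ => f (z : OnePoint ℂ)) {z : ℂ | (z : OnePoint ℂ) ∈ Ω} ∧
    DifferentiableOn ℂ (fun w : ℂ => f (sphereCoordInfty w)) {w : ℂ | sphereCoordInfty w ∈ Ω}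

/-- The complement of a plane set `E` in the Riemann sphere. -/
def sphereCompl (E : Set ℂ) : Set (OnePoint ℂ) :=
  ((fun z : ℂ => (z : OnePoint ℂ)) '' E)ᶜ

/-- The class `A(Ω)`, for `Ω` the complement of `E` in the Riemann sphere: the functions that are
continuous on the whole sphere and holomorphic on `Ω`. -/
def classA (E : Set ℂ) : Set (OnePoint ℂ → ℂ) :=
  {f | Continuous f ∧ SphereHolomorphicOn f (sphereCompl E)}

/-- `E` is `A`-removable: every continuous function on the Riemann sphere that is holomorphic
outside `E` is constant. (Used for compact `E`.) -/
def IsARemovable (E : Set ℂ) : Prop :=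
  ∀ f ∈ classA E, ∃ c : ℂ, ∀ x : OnePoint ℂ, f x = c

/-!
Let `f` be continuous on the sphere and holomorphic off `E ∪ F`. The point is that removability of
`E` makes `f` holomorphic near every point `c` outside `F`; then `f` is holomorphic off `F`, and
removability of `F` makes it constant.

To see this, write `C[k](z) = ∫ k(ζ) / (z - ζ)` for the Cauchy transform with respect to area, let
`h` be a compactly supported density, and consider Vitushkin's localization
`T = f C[h] - C[f h]`, that is, `T(z) = ∫ (f(z) - f(ζ)) / (z - ζ) h(ζ)`. Cauchy transforms of
continuous compactly supported densities are continuous, vanish at infinity, and are holomorphic off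
the support of the density (`continuous_cauchyTransform`, `tendsto_cauchyTransform_cocompact`,
`differentiableAt_cauchyTransform`). Moreover `T` is holomorphic wherever `f` is, being an integral
of uniformly bounded holomorphic difference quotients (`differentiableAt_localization`).

Take `h(ζ) = p(|ζ - c|) (ζ - c)` with `p ≥ 0` supported in `[R / 2, R]`, where the closed disc of
radius `R` around `c` misses `F`. Cauchy's theorem on circles gives `C[h] = 0` outside this disc
(`cauchyTransform_annularDensity_eq_zero`), so that `T = -C[f h]` there; in particular `T` is
holomorphic near `F` and tends to `0` at infinity. Hence `T` belongs to `classA E` and vanishes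
identically, i.e. `f C[h] = C[f h]`. Both transforms are holomorphic near `c`, since `h` vanishes
there, and `C[h](c) = -∫ p(|ζ - c|) ≠ 0`, so `f` is holomorphic near `c`
(`differentiableAt_of_isARemovable`).
-/

open MeasureTheory Metric Set Filter Topology

/-! ### Holomorphic dependence of integrals on a parameter -/

/-- By Cauchy's estimate, a bound on the integrand alone controls its derivative in the
parameter. -/
theorem differentiableAt_integral_of_norm_le {α : Type*} [MeasurableSpace α] {μ : Measure α}
    {F : ℂ → α → ℂ} {bound : α → ℝ} {z₀ : ℂ} {r : ℝ} (hr : 0 < r)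
    (hmeas : ∀ z ∈ ball z₀ r, AEStronglyMeasurable (F z) μ)
    (hdiff : ∀ a, DifferentiableOn ℂ (fun z => F z a) (ball z₀ r))
    (hbound : ∀ a, ∀ z ∈ ball z₀ r, ‖F z a‖ ≤ bound a) (hint : Integrable bound μ) :
    DifferentiableAt ℂ (fun z => ∫ a, F z a ∂μ) z₀ := by
  have hball : ball z₀ r ∈ 𝓝 z₀ := ball_mem_nhds z₀ hr
  have hz₀ : z₀ ∈ ball z₀ r := mem_ball_self hr
  have hd : ∀ a, ∀ z ∈ ball z₀ r, DifferentiableAt ℂ (fun z => F z a) z := fun a z hz =>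
    (hdiff a).differentiableAt (isOpen_ball.mem_nhds hz)
  have hsub : ∀ z ∈ ball z₀ (r / 2), closedBall z (r / 4) ⊆ ball z₀ r := fun z hz w hw => by
    rw [mem_ball] at hz ⊢
    rw [mem_closedBall] at hw
    linarith [dist_triangle w z z₀]
  -- The derivative is the limit of difference quotients along a sequence, hence measurable.
  have hF' : AEStronglyMeasurable (fun a => deriv (fun z => F z a) z₀) μ := by
    let u : ℕ → ℂ := fun n => z₀ + (r / (n + 2) : ℝ)
    have hu0 : ∀ n : ℕ, 0 < r / (n + 2 : ℝ) := fun n => by positivity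
    have hu : ∀ n, u n ∈ ball z₀ r := fun n => by
      have : r / (n + 2 : ℝ) < r := div_lt_self hr (by linarith [n.cast_nonneg (α := ℝ)])
      simp only [u, mem_ball, dist_self_add_left, Complex.norm_real, Real.norm_eq_abs,
        abs_of_pos (hu0 n)]
      exact this
    have hlim : Tendsto u atTop (𝓝[≠] z₀) := by
      refine tendsto_nhdsWithin_iff.2 ⟨?_, Eventually.of_forall fun n => ?_⟩
      · have h1 : Tendsto (fun n : ℕ => r / (n + 2 : ℝ)) atTop (𝓝 0) :=
          tendsto_const_nhds.div_atTop
            (tendsto_atTop_add_const_right _ _ tendsto_natCast_atTop_atTop)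
        have h2 := (Complex.continuous_ofReal.tendsto 0).comp h1
        simpa [u, Function.comp_def] using h2.const_add z₀
      · simp only [u, mem_compl_iff, mem_singleton_iff, add_eq_left, Complex.ofReal_eq_zero]
        exact (hu0 n).ne'
    refine aestronglyMeasurable_of_tendsto_ae atTop
      (f := fun n a => slope (fun z => F z a) z₀ (u n)) (fun n => ?_) (ae_of_all _ fun a => ?_)
    · simp only [slope_def_module]
      exact ((hmeas _ (hu n)).sub (hmeas _ hz₀)).const_smul (u n - z₀)⁻¹
    · exact (hasDerivAt_iff_tendsto_slope.1 (hd a z₀ hz₀).hasDerivAt).comp hlim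
  refine (hasDerivAt_integral_of_dominated_loc_of_deriv_le (F := F)
    (F' := fun z a => deriv (fun z => F z a) z) (bound := fun a => bound a / (r / 4))
    (ball_mem_nhds z₀ (half_pos hr)) (eventually_of_mem hball hmeas)
    (hint.mono' (hmeas z₀ hz₀) (ae_of_all _ fun a => hbound a z₀ hz₀)) hF'
    (ae_of_all _ fun a z hz => ?_) (hint.div_const _)
    (ae_of_all _ fun a z hz => ?_)).2.differentiableAt
  · refine Complex.norm_deriv_le_of_forall_mem_sphere_norm_le (by positivity) ?_
      fun w hw => hbound a w (hsub z hz (sphere_subset_closedBall hw))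
    refine DifferentiableOn.diffContOnCl ?_
    exact (hdiff a).mono ((closure_ball_subset_closedBall).trans (hsub z hz))
  · exact (hd a z (hsub z hz (mem_closedBall_self (by positivity)))).hasDerivAt

/-! ### The Cauchy transform -/

/-- The Cauchy transform `z ↦ ∫ k(ζ) / (z - ζ)` of a density `k` with respect to area measure,
without the usual factor `1 / π`. -/
noncomputable def cauchyTransform (k : ℂ → ℂ) (z : ℂ) : ℂ :=
  ∫ ζ, k ζ * (z - ζ)⁻¹

theorem locallyIntegrable_complex_inv : LocallyIntegrable (fun w : ℂ => w⁻¹) := by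
  refine locallyIntegrable_of_norm_le_rpow (C := 1) (α := 1) (by simp) (by simp)
    (ae_of_all _ fun x => ?_) (measurable_inv.aestronglyMeasurable)
  simp [Real.rpow_neg_one]

theorem integrable_cauchyTransform {k : ℂ → ℂ} (hk : Continuous k) (hc : HasCompactSupport k)
    (z : ℂ) : Integrable fun ζ => k ζ * (z - ζ)⁻¹ :=
  hc.convolutionExists_left (ContinuousLinearMap.mul ℝ ℂ) hk locallyIntegrable_complex_inv z

theorem continuous_cauchyTransform {k : ℂ → ℂ} (hk : Continuous k) (hc : HasCompactSupport k) :
    Continuous (cauchyTransform k) :=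
  hc.continuous_convolution_left (ContinuousLinearMap.mul ℝ ℂ) hk locallyIntegrable_complex_inv

theorem tendsto_cauchyTransform_cocompact {k : ℂ → ℂ} (hk : Continuous k)
    (hc : HasCompactSupport k) : Tendsto (cauchyTransform k) (cocompact ℂ) (𝓝 0) := by
  obtain ⟨R, hR⟩ := hc.isCompact.isBounded.subset_closedBall (0 : ℂ)
  have hfar : ∀ᶠ z in cocompact ℂ, R + 1 ≤ ‖z‖ :=
    (tendsto_norm_cocompact_atTop (E := ℂ)).eventually_ge_atTop (R + 1)
  rw [← Metric.cobounded_eq_cocompact] at hfar ⊢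
  have : (Bornology.cobounded ℂ).IsCountablyGenerated := by
    rw [← comap_norm_atTop]
    infer_instance
  rw [show (0 : ℂ) = ∫ _ : ℂ, (0 : ℂ) by simp]
  refine tendsto_integral_filter_of_dominated_convergence (fun ζ => ‖k ζ‖)
    (Eventually.of_forall fun z => (integrable_cauchyTransform hk hc z).aestronglyMeasurable)
    (hfar.mono fun z hz => ae_of_all _ fun ζ => ?_) (hk.integrable_of_hasCompactSupport hc).norm
    (ae_of_all _ fun ζ => ?_)
  · by_cases hζ : ζ ∈ tsupport k
    · have h1 : ‖ζ‖ ≤ R := by simpa using hR hζ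
      have h2 : 1 ≤ ‖z - ζ‖ := by linarith [norm_sub_norm_le z ζ]
      rw [norm_mul, norm_inv]
      exact mul_le_of_le_one_right (norm_nonneg _) (inv_le_one_of_one_le₀ h2)
    · simp [image_eq_zero_of_notMem_tsupport hζ]
  · have h : Tendsto (fun z : ℂ => z - ζ) (cocompact ℂ) (cocompact ℂ) :=
      (Homeomorph.subRight ζ).isClosedEmbedding.tendsto_cocompact
    rw [← Metric.cobounded_eq_cocompact] at h
    simpa using (tendsto_inv₀_cobounded.comp h).const_mul (k ζ)

theorem differentiableAt_cauchyTransform {k : ℂ → ℂ} (hk : Continuous k)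
    (hc : HasCompactSupport k) {z₀ : ℂ} (hz₀ : z₀ ∉ tsupport k) :
    DifferentiableAt ℂ (cauchyTransform k) z₀ := by
  obtain ⟨d, hd, hsub⟩ := Metric.isOpen_iff.1 (isClosed_tsupport k).isOpen_compl z₀ hz₀
  have hfar : ∀ ζ ∈ tsupport k, ∀ z ∈ ball z₀ (d / 2), d / 2 ≤ ‖z - ζ‖ := by
    intro ζ hζ z hz
    have h1 : d ≤ dist ζ z₀ := by
      by_contra! h
      exact hsub h hζ
    rw [mem_ball] at hz
    rw [← dist_eq_norm, dist_comm]
    linarith [dist_triangle ζ z z₀]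
  refine differentiableAt_integral_of_norm_le (half_pos hd)
    (bound := fun ζ => ‖k ζ‖ * (d / 2)⁻¹)
    (fun z _ => (integrable_cauchyTransform hk hc z).aestronglyMeasurable) (fun ζ => ?_)
    (fun ζ z hz => ?_) ((hk.integrable_of_hasCompactSupport hc).norm.mul_const _)
  · by_cases hζ : ζ ∈ tsupport k
    · refine ((differentiableOn_id.sub_const ζ).inv fun z hz h0 => ?_).const_mul (k ζ)
      have := hfar ζ hζ z hz
      simp only [id] at h0
      rw [h0, norm_zero] at this
      linarith
    · simp [image_eq_zero_of_notMem_tsupport hζ]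
  · by_cases hζ : ζ ∈ tsupport k
    · rw [norm_mul, norm_inv]
      have := hfar ζ hζ z hz
      gcongr
    · simp [image_eq_zero_of_notMem_tsupport hζ]

/-! ### Localization of a continuous function -/

theorem dslope_mul_ae_eq {f h : ℂ → ℂ} (z : ℂ) :
    (fun ζ => dslope f ζ z * h ζ) =ᵐ[volume]
      fun ζ => f z * (h ζ * (z - ζ)⁻¹) - f ζ * h ζ * (z - ζ)⁻¹ := by
  filter_upwards [compl_mem_ae_iff.2 (measure_singleton (μ := volume) z)] with ζ hζ
  have hne : z ≠ ζ := fun h => hζ h.symm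
  rw [dslope_of_ne _ hne, slope_def_module, smul_eq_mul]
  ring

theorem integral_dslope_mul {f h : ℂ → ℂ} (hf : Continuous f) (hh : Continuous h)
    (hc : HasCompactSupport h) (z : ℂ) :
    ∫ ζ, dslope f ζ z * h ζ =
      f z * cauchyTransform h z - cauchyTransform (fun ζ => f ζ * h ζ) z := by
  rw [integral_congr_ae (dslope_mul_ae_eq z), integral_sub, integral_const_mul]
  · rfl
  · exact (integrable_cauchyTransform hh hc z).const_mul _
  · exact integrable_cauchyTransform (hf.mul hh) (hc.mul_left) z

/-- The localization `f C[h] - C[f h]` is holomorphic wherever `f` is. It is an integral of the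
difference quotients `z ↦ (f z - f ζ) / (z - ζ)`, which are holomorphic in `z`, across `z = ζ` too,
and bounded uniformly in `ζ`: by a Lipschitz constant of `f` for `ζ` near `z₀`, by the sup norm of
`f` for `ζ` away from `z₀`. -/
theorem differentiableAt_localization {f h : ℂ → ℂ} (hf : Continuous f) {M : ℝ}
    (hM : ∀ z, ‖f z‖ ≤ M) (hh : Continuous h) (hc : HasCompactSupport h) {z₀ : ℂ}
    (hz₀ : ∀ᶠ z in 𝓝 z₀, DifferentiableAt ℂ f z) :
    DifferentiableAt ℂ
      (fun z => f z * cauchyTransform h z - cauchyTransform (fun ζ => f ζ * h ζ) z) z₀ := by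
  simp_rw [← integral_dslope_mul hf hh hc]
  have han : AnalyticAt ℂ f z₀ := Complex.analyticAt_iff_eventually_differentiableAt.2 hz₀
  obtain ⟨K, t, ht, hK⟩ := (han.contDiffAt (n := 1)).exists_lipschitzOnWith
  obtain ⟨d, hd, hsub⟩ := Metric.mem_nhds_iff.1 (inter_mem ht hz₀)
  have hM0 : 0 ≤ M := (norm_nonneg _).trans (hM 0)
  have hhalf : ball z₀ (d / 2) ⊆ ball z₀ d := ball_subset_ball (by linarith)
  have hdiff : DifferentiableOn ℂ f (ball z₀ d) := fun z hz =>
    (hsub hz).2.differentiableWithinAt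
  refine differentiableAt_integral_of_norm_le (half_pos hd)
    (bound := fun ζ => (K + 2 * M / (d / 2)) * ‖h ζ‖) (fun z _ => ?_) (fun ζ => ?_)
    (fun ζ z hz => ?_) ((hh.integrable_of_hasCompactSupport hc).norm.const_mul _)
  · refine AEStronglyMeasurable.congr ?_ (dslope_mul_ae_eq z).symm
    exact (((integrable_cauchyTransform hh hc z).const_mul _).sub
      (integrable_cauchyTransform (hf.mul hh) hc.mul_left z)).aestronglyMeasurable
  · refine DifferentiableOn.mul_const ?_ _
    by_cases hζ : ζ ∈ ball z₀ d
    · exact ((Complex.differentiableOn_dslope (isOpen_ball.mem_nhds hζ)).2 hdiff).mono hhalf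
    · exact ((differentiableOn_dslope_of_notMem hζ).2 hdiff).mono hhalf
  · rw [norm_mul]
    gcongr
    have hzd := hhalf hz
    by_cases hζ : ζ ∈ ball z₀ d
    · refine le_add_of_le_of_nonneg ?_ (by positivity)
      rcases eq_or_ne z ζ with rfl | hne
      · rw [dslope_same]
        exact norm_deriv_le_of_lipschitzOn (isOpen_ball.mem_nhds hζ)
          (hK.mono fun w hw => (hsub hw).1)
      · rw [dslope_of_ne _ hne, slope_def_module, norm_smul, norm_inv,
          inv_mul_le_iff₀ (norm_pos_iff.2 (sub_ne_zero.2 hne)), mul_comm]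
        exact hK.norm_sub_le (hsub hzd).1 (hsub hζ).1
    · refine le_add_of_nonneg_of_le K.2 ?_
      have hfar : d / 2 ≤ ‖z - ζ‖ := by
        rw [mem_ball, not_lt] at hζ
        rw [mem_ball] at hz
        rw [← dist_eq_norm, dist_comm]
        linarith [dist_triangle ζ z z₀]
      have hne : z ≠ ζ := by
        rintro rfl
        exact hζ hzd
      rw [dslope_of_ne _ hne, slope_def_module, norm_smul, norm_inv, div_eq_inv_mul]
      have : ‖f z - f ζ‖ ≤ 2 * M := (norm_sub_le _ _).trans (by linarith [hM z, hM ζ])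
      gcongr

/-! ### Radial densities -/

/-- A radial density times `u` is orthogonal to every function holomorphic near its support: by
Cauchy's theorem already the integral over each circle vanishes. -/
theorem integral_radial_mul_eq_zero {p : ℝ → ℝ} (hp : Continuous p) {R R' : ℝ} (hR : R < R')
    (hpR : ∀ ρ, R ≤ ρ → p ρ = 0) {g : ℂ → ℂ} (hg : DifferentiableOn ℂ g (ball 0 R')) :
    ∫ u : ℂ, (p ‖u‖ : ℂ) * u * g u = 0 := by
  have key : ∀ ρ θ : ℝ, Complex.polarCoord.symm (ρ, θ) = circleMap 0 ρ θ := fun ρ θ => by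
    simp [circleMap, Complex.exp_mul_I]
  have hcirc : ∀ ρ : ℝ, 0 < ρ → ρ < R' →
      ∫ θ in Ioo (-Real.pi) Real.pi, circleMap 0 ρ θ * g (circleMap 0 ρ θ) = 0 := by
    intro ρ h0 hρ
    have hcl : closedBall (0 : ℂ) ρ ⊆ ball 0 R' := closedBall_subset_ball hρ
    have h1 : (∮ z in C(0, ρ), g z) = 0 :=
      Complex.circleIntegral_eq_zero_of_differentiable_on_off_countable h0.le countable_empty
        (hg.continuousOn.mono hcl) fun z hz =>
          hg.differentiableAt (isOpen_ball.mem_nhds (hcl (ball_subset_closedBall hz.1)))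
    simp only [circleIntegral, deriv_circleMap, smul_eq_mul] at h1
    have h2 : (∫ θ in (0 : ℝ)..2 * Real.pi, circleMap 0 ρ θ * g (circleMap 0 ρ θ)) = 0 := by
      have h3 : (∫ θ in (0 : ℝ)..2 * Real.pi, Complex.I *
          (circleMap 0 ρ θ * g (circleMap 0 ρ θ))) = 0 := by
        refine (intervalIntegral.integral_congr fun θ _ => ?_).trans h1
        ring
      rw [intervalIntegral.integral_const_mul] at h3
      exact (mul_eq_zero.1 h3).resolve_left Complex.I_ne_zero
    have hper : Function.Periodic (fun θ => circleMap 0 ρ θ * g (circleMap 0 ρ θ))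
        (2 * Real.pi) := fun θ => by simp only [periodic_circleMap 0 ρ θ]
    have h4 := hper.intervalIntegral_add_eq (-Real.pi) 0
    rw [zero_add, h2, show -Real.pi + 2 * Real.pi = Real.pi by ring,
      intervalIntegral.integral_of_le (by linarith [Real.pi_pos]),
      integral_Ioc_eq_integral_Ioo] at h4
    exact h4
  -- Fubini in polar coordinates; `p` cuts the domain down to a compact rectangle.
  rw [← Complex.integral_comp_polarCoord_symm, polarCoord_target, Measure.volume_eq_prod,
    setIntegral_prod]
  · refine setIntegral_eq_zero_of_forall_eq_zero fun ρ hρ => ?_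
    rcases le_or_gt R ρ with h | h
    · simp [key, abs_of_pos (show 0 < ρ from hρ), hpR ρ h]
    · have := hcirc ρ hρ (h.trans hR)
      simp only [key, norm_circleMap_zero, abs_of_pos (show 0 < ρ from hρ), mul_assoc]
      rw [integral_smul, integral_const_mul, this]
      simp
  · refine IntegrableOn.of_forall_sdiff_eq_zero (s := Icc 0 R ×ˢ Icc (-Real.pi) Real.pi) ?_
      (measurableSet_Ioi.prod measurableSet_Ioo) ?_
    · refine ContinuousOn.integrableOn_compact (isCompact_Icc.prod isCompact_Icc) ?_
      have hcm : Continuous fun x : ℝ × ℝ => Complex.polarCoord.symm x := by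
        simp only [Complex.polarCoord_symm_apply]
        fun_prop
      refine continuous_fst.continuousOn.smul (ContinuousOn.mul (by fun_prop) ?_)
      refine hg.continuousOn.comp hcm.continuousOn fun x hx => ?_
      rw [mem_ball_zero_iff, Complex.norm_polarCoord_symm, abs_of_nonneg hx.1.1]
      exact hx.1.2.trans_lt hR
    · rintro ⟨ρ, θ⟩ ⟨⟨h1, h2⟩, h3⟩
      have h1' : 0 < ρ := h1
      have : R ≤ ρ := by
        by_contra! h
        exact h3 ⟨⟨h1'.le, h.le⟩, Ioo_subset_Icc_self h2⟩
      simp [key, abs_of_pos h1', hpR ρ this]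

/-! ### The class `A` -/

theorem coe_mem_sphereCompl {E : Set ℂ} {z : ℂ} :
    (z : OnePoint ℂ) ∈ sphereCompl E ↔ z ∉ E := by
  simp [sphereCompl]

theorem differentiableOn_of_mem_classA {E : Set ℂ} {f : OnePoint ℂ → ℂ} (hf : f ∈ classA E) :
    DifferentiableOn ℂ (fun z : ℂ => f z) Eᶜ := by
  simpa only [coe_mem_sphereCompl, ← compl_def] using hf.2.1

theorem continuousAt_sphereCoordInfty_zero : ContinuousAt sphereCoordInfty 0 := by
  have h0 : sphereCoordInfty 0 = ∞ := if_pos rfl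
  rw [continuousAt_iff_punctured_nhds, h0]
  have h1 : Tendsto (fun w : ℂ => ((w⁻¹ : ℂ) : OnePoint ℂ)) (𝓝[≠] 0) (𝓝 ∞) := by
    have h2 := OnePoint.tendsto_coe_infty (X := ℂ)
    rw [coclosedCompact_eq_cocompact, ← Metric.cobounded_eq_cocompact] at h2
    exact h2.comp tendsto_inv₀_nhdsNE_zero
  refine h1.congr' (eventually_mem_nhdsWithin.mono fun w hw => ?_)
  exact (if_neg hw).symm

/-- Holomorphy at infinity and in the coordinate `1 / z` is automatic, by the removable
singularity theorem. -/
theorem mem_classA_of_differentiableOn {E : Set ℂ} (hE : IsCompact E) {f : OnePoint ℂ → ℂ}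
    (hf : Continuous f) (hd : DifferentiableOn ℂ (fun z : ℂ => f z) Eᶜ) : f ∈ classA E := by
  refine ⟨hf, ?_, ?_⟩
  · simpa only [coe_mem_sphereCompl, ← compl_def] using hd
  have hne : ∀ w : ℂ, w ≠ 0 → sphereCoordInfty w ∈ sphereCompl E →
      DifferentiableAt ℂ (fun w : ℂ => f (sphereCoordInfty w)) w := by
    intro w hw hwE
    rw [sphereCoordInfty, if_neg hw, coe_mem_sphereCompl] at hwE
    have h1 : DifferentiableAt ℂ (fun z : ℂ => f z) w⁻¹ :=
      hd.differentiableAt (hE.isClosed.isOpen_compl.mem_nhds hwE)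
    refine (h1.comp w (differentiableAt_inv hw)).congr_of_eventuallyEq ?_
    filter_upwards [isOpen_ne.mem_nhds hw] with v hv
    simp [sphereCoordInfty, if_neg (show ¬v = 0 from hv)]
  have hopen : IsOpen (sphereCompl E) :=
    (hE.image OnePoint.continuous_coe).isClosed.isOpen_compl
  have h0 : sphereCoordInfty 0 = ∞ := if_pos rfl
  intro w hw
  rcases eq_or_ne w 0 with rfl | hw0
  · refine (Complex.analyticAt_of_differentiable_on_punctured_nhds_of_continuousAt ?_
      (hf.continuousAt.comp continuousAt_sphereCoordInfty_zero)).differentiableAt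
      |>.differentiableWithinAt
    filter_upwards [nhdsWithin_le_nhds
      (continuousAt_sphereCoordInfty_zero.preimage_mem_nhds (hopen.mem_nhds hw)),
      eventually_mem_nhdsWithin] with v hv hv0
    exact hne v hv0 hv
  · exact (hne w hw0 hw).differentiableWithinAt

/-! ### A localizing density -/

/-- The radial profile of the localizing density: a parabolic arch over
`[R / 2, R]`, extended by zero. -/
noncomputable def radialProfile (R ρ : ℝ) : ℝ :=
  max 0 ((ρ - R / 2) * (R - ρ))

theorem continuous_radialProfile (R : ℝ) : Continuous (radialProfile R) := by
  unfold radialProfile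
  fun_prop

theorem radialProfile_nonneg (R ρ : ℝ) : 0 ≤ radialProfile R ρ :=
  le_max_left _ _

theorem radialProfile_of_ge {R ρ : ℝ} (hR : 0 < R) (h : R ≤ ρ) : radialProfile R ρ = 0 :=
  max_eq_left (mul_nonpos_of_nonneg_of_nonpos (by linarith) (by linarith))

theorem radialProfile_of_le {R ρ : ℝ} (hR : 0 < R) (h : ρ ≤ R / 2) : radialProfile R ρ = 0 :=
  max_eq_left (mul_nonpos_of_nonpos_of_nonneg (by linarith) (by linarith))

/-- The density `p(|ζ - c|) (ζ - c)`, where `p` is `radialProfile R`. It is `∂φ/∂ζ̄` for the radial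
cutoff function `φ(ζ) = -∫ 2 ρ p(ρ) dρ` over `ρ > |ζ - c|`, which is constant on the disc of radius
`R / 2` around `c` and vanishes outside the disc of radius `R`. -/
noncomputable def annularDensity (c : ℂ) (R : ℝ) (ζ : ℂ) : ℂ :=
  radialProfile R ‖ζ - c‖ * (ζ - c)

theorem continuous_annularDensity (c : ℂ) (R : ℝ) : Continuous (annularDensity c R) := by
  have := continuous_radialProfile R
  unfold annularDensity
  fun_prop

theorem tsupport_annularDensity_subset {c : ℂ} {R : ℝ} (hR : 0 < R) :
    tsupport (annularDensity c R) ⊆ closedBall c R \ ball c (R / 2) := by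
  refine closure_minimal (fun ζ hζ => ?_) (isClosed_closedBall.sdiff isOpen_ball)
  rw [Set.mem_sdiff, mem_closedBall, mem_ball, not_lt, dist_eq_norm]
  by_contra h
  refine hζ ?_
  rw [not_and_or, not_le, not_le] at h
  rcases h with h | h
  · simp [annularDensity, radialProfile_of_ge hR h.le]
  · simp [annularDensity, radialProfile_of_le hR h.le]

theorem hasCompactSupport_annularDensity {c : ℂ} {R : ℝ} (hR : 0 < R) :
    HasCompactSupport (annularDensity c R) :=
  HasCompactSupport.of_support_subset_isCompact (isCompact_closedBall c R)
    ((subset_tsupport _).trans ((tsupport_annularDensity_subset hR).trans sdiff_subset))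

theorem cauchyTransform_annularDensity_eq_zero {c : ℂ} {R : ℝ} (hR : 0 < R) {z : ℂ}
    (hz : R < ‖z - c‖) : cauchyTransform (annularDensity c R) z = 0 := by
  have hg : DifferentiableOn ℂ (fun u : ℂ => (z - c - u)⁻¹) (ball 0 ‖z - c‖) := by
    refine (differentiableOn_id.const_sub (z - c)).inv fun u hu h0 => ?_
    rw [id] at h0
    rw [mem_ball_zero_iff, ← sub_eq_zero.1 h0] at hu
    exact lt_irrefl _ hu
  rw [cauchyTransform, ← integral_add_right_eq_self _ c,
    ← integral_radial_mul_eq_zero (continuous_radialProfile R) hz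
      (fun ρ h => radialProfile_of_ge hR h) hg]
  congr 1
  ext u
  simp [annularDensity, sub_sub, add_comm]

/-- At the center the two factors `ζ - c` cancel, leaving minus the integral of the profile. -/
theorem cauchyTransform_annularDensity_center_ne_zero {c : ℂ} {R : ℝ} (hR : 0 < R) :
    cauchyTransform (annularDensity c R) c ≠ 0 := by
  have hcont : Continuous fun ζ : ℂ => radialProfile R ‖ζ - c‖ :=
    (continuous_radialProfile R).comp (by fun_prop)
  have heq : cauchyTransform (annularDensity c R) c =
      ((-∫ ζ, radialProfile R ‖ζ - c‖ : ℝ) : ℂ) := by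
    rw [← integral_neg, ← integral_complex_ofReal, cauchyTransform]
    congr 1
    ext ζ
    rcases eq_or_ne ζ c with rfl | h
    · simp [radialProfile_of_le hR (half_pos hR).le]
    · have h1 : ζ - c ≠ 0 := sub_ne_zero.2 h
      rw [annularDensity, ← neg_sub ζ c, inv_neg, mul_neg, mul_assoc, mul_inv_cancel₀ h1]
      simp
  have hsupp : HasCompactSupport fun ζ : ℂ => radialProfile R ‖ζ - c‖ := by
    refine HasCompactSupport.intro (isCompact_closedBall c R) fun ζ hζ => ?_
    rw [mem_closedBall, not_le, dist_eq_norm] at hζ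
    exact radialProfile_of_ge hR hζ.le
  have hpos : 0 < ∫ ζ, radialProfile R ‖ζ - c‖ := by
    refine hcont.integral_pos_of_hasCompactSupport_nonneg_nonzero hsupp
      (fun ζ => radialProfile_nonneg _ _) (x := c + (3 / 4 * R : ℝ)) ?_
    have : ‖c + ((3 / 4 * R : ℝ) : ℂ) - c‖ = 3 / 4 * R := by
      rw [add_sub_cancel_left, Complex.norm_real, Real.norm_of_nonneg (by positivity)]
    rw [this, radialProfile]
    refine (lt_max_of_lt_right ?_).ne'
    have h2 : (3 / 4 * R - R / 2) * (R - 3 / 4 * R) = R ^ 2 / 16 := by ring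
    rw [h2]
    positivity
  rw [heq, Complex.ofReal_ne_zero]
  exact (neg_neg_of_pos hpos).ne

/-! ### Removing the part of the singular set outside `F` -/

/-- Removability is local: the part of the singular set away from `F` is removable when `E` is.
The localization `f C[h] - C[f h]`, with `h` supported in a disc around `c` disjoint from `F`,
belongs to `classA E`, hence vanishes identically, and dividing by `C[h]` expresses `f` near `c`
through Cauchy transforms that are holomorphic there. -/
theorem differentiableAt_of_isARemovable {E F : Set ℂ} (hE : IsCompact E) (hF : IsCompact F)
    (hEA : IsARemovable E) {f : OnePoint ℂ → ℂ} (hf : f ∈ classA (E ∪ F)) {c : ℂ} (hc : c ∉ F) :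
    DifferentiableAt ℂ (fun z : ℂ => f z) c := by
  obtain ⟨R, hR, hRF⟩ := nhds_basis_closedBall.mem_iff.1 (hF.isClosed.isOpen_compl.mem_nhds hc)
  set h : ℂ → ℂ := annularDensity c R with hdef
  set φ : ℂ → ℂ := fun z => f z with hφ
  have hcontφ : Continuous φ := hf.1.comp OnePoint.continuous_coe
  have hh : Continuous h := continuous_annularDensity c R
  have hs : HasCompactSupport h := hasCompactSupport_annularDensity hR
  have hφh : Continuous fun ζ => φ ζ * h ζ := hcontφ.mul hh
  have hφs : HasCompactSupport fun ζ => φ ζ * h ζ := hs.mul_left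
  have htsupp : tsupport (fun ζ => φ ζ * h ζ) ⊆ closedBall c R \ ball c (R / 2) :=
    (tsupport_mul_subset_right).trans (tsupport_annularDensity_subset hR)
  obtain ⟨M, hM⟩ : ∃ M, ∀ z, ‖φ z‖ ≤ M := by
    obtain ⟨M, hM⟩ := isBounded_iff_forall_norm_le.1 (isCompact_range hf.1).isBounded
    exact ⟨M, fun z => hM _ (mem_range_self _)⟩
  let T : ℂ → ℂ := fun z => φ z * cauchyTransform h z - cauchyTransform (fun ζ => φ ζ * h ζ) z
  have hT_far : ∀ z, R < ‖z - c‖ → T z = -cauchyTransform (fun ζ => φ ζ * h ζ) z := fun z hz => by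
    simp only [T, hdef, cauchyTransform_annularDensity_eq_zero hR hz, mul_zero, zero_sub]
  have hT_cont : Continuous T :=
    (hcontφ.mul (continuous_cauchyTransform hh hs)).sub (continuous_cauchyTransform hφh hφs)
  have hT_infty : Tendsto T (cocompact ℂ) (𝓝 0) := by
    have h1 : Tendsto (fun z => -cauchyTransform (fun ζ => φ ζ * h ζ) z) (cocompact ℂ) (𝓝 0) := by
      simpa using (tendsto_cauchyTransform_cocompact hφh hφs).neg
    refine h1.congr' ?_
    filter_upwards [(isCompact_closedBall c R).compl_mem_cocompact] with z hz
    rw [mem_compl_iff, mem_closedBall, not_le, dist_eq_norm] at hz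
    exact (hT_far z hz).symm
  have hT_diff : DifferentiableOn ℂ T Eᶜ := by
    intro z hz
    refine DifferentiableAt.differentiableWithinAt ?_
    -- Points of `F` lie outside the disc, where `C[h] = 0`; at the other points `f` is holomorphic.
    by_cases hzF : z ∈ F
    · have hfar : ∀ᶠ w in 𝓝 z, R < ‖w - c‖ := by
        have : R < ‖z - c‖ := by
          rw [← dist_eq_norm, ← not_le, ← mem_closedBall]
          exact fun hzR => hRF hzR hzF
        exact (continuous_id.sub continuous_const).norm.continuousAt.eventually
          (lt_mem_nhds this)
      refine DifferentiableAt.congr_of_eventuallyEq ?_ (hfar.mono hT_far)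
      refine (differentiableAt_cauchyTransform hφh hφs fun hzs => ?_).neg
      exact hRF (htsupp hzs).1 hzF
    · refine differentiableAt_localization hcontφ hM hh hs ?_
      have hopen : IsOpen (E ∪ F)ᶜ := (hE.union hF).isClosed.isOpen_compl
      filter_upwards [hopen.mem_nhds (show z ∈ (E ∪ F)ᶜ by simp_all)] with w hw
      exact (differentiableOn_of_mem_classA hf).differentiableAt (hopen.mem_nhds hw)
  let G : OnePoint ℂ → ℂ := fun x => x.elim 0 T
  have hG_cont : Continuous G := by
    rw [OnePoint.continuous_iff, coclosedCompact_eq_cocompact]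
    exact ⟨hT_infty, hT_cont⟩
  have hT0 : ∀ z, T z = 0 := by
    obtain ⟨a, ha⟩ := hEA G (mem_classA_of_differentiableOn hE hG_cont hT_diff)
    intro z
    exact (ha z).trans (ha ∞).symm
  have hcs : c ∉ closedBall c R \ ball c (R / 2) := fun h => h.2 (mem_ball_self (half_pos hR))
  have hne : cauchyTransform h c ≠ 0 := cauchyTransform_annularDensity_center_ne_zero hR
  refine ((differentiableAt_cauchyTransform hφh hφs fun hm => hcs (htsupp hm)).div
    (differentiableAt_cauchyTransform hh hs fun hm =>
      hcs (tsupport_annularDensity_subset hR hm)) hne).congr_of_eventuallyEq ?_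
  filter_upwards [(continuous_cauchyTransform hh hs).continuousAt.eventually_ne hne] with z hz
  exact (eq_div_iff hz).2 (sub_eq_zero.1 (hT0 z))

theorem mainTheorem7 (E F : Set ℂ) (hE : IsCompact E) (hF : IsCompact F)
    (hEA : IsARemovable E) (hFA : IsARemovable F) : IsARemovable (E ∪ F) := by
  intro f hf
  exact hFA f (mem_classA_of_differentiableOn hF hf.1 fun z hz =>
    (differentiableAt_of_isARemovable hE hF hEA hf hz).differentiableWithinAt)
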